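/- **Setting.** Let $E$ be a finite-dimensional real vector space, $A\in\mathrm{End}_{\mathbb R}(E)$ and $f\in E^*$. The homogeneous program $P(A,f)$: $\texttt{while }(f\cdot x>0)\ \{x:=Ax\}$ terminates on $x\in E$ if $f(A^kx)\le 0$ for some $k\ge 0$. The set $ANT(P(A,f))$ of asymptotically non-terminating inputs is the set of $x\in E$ such that, for some $k\ge 0$, the program does not terminate on $A^{k}x$. Let $\mathrm{Spec}(A)$ be the set of complex eigenvalues of $A$, $\mathrm{Spec}_{>0}(A)$ the set of positive real ones, and $|\mathrm{Spec}(A)|=\{|\mu| : \mu\in\mathrm{Spec}(A)\}$. For an eigenvalue $\lambda$ let $d_\lambda$ be its multiplicity in the characteristic polynomial. For real $\lambda$ put $E_\lambda=\ker (A-\lambda)^{d_\lambda}$, and for non-real $\mu$ put $E_{\{\mu,\bar\mu\}}=\ker\big((A-\mu)(A-\bar\mu)\big)^{d_\mu}$. Then $E$ is the direct sum of the $E_\lambda$ ($\lambda$ a real eigenvalue) and the $E_{\{\mu,\bar\mu\}}$ ($\mu$ an eigenvalue with $\mathrm{Im}\,\mu>0$). Write $x_\lambda$, $x_\mu$ for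 the components of $x\in E$ in this decomposition. For $\tau>0$ let $A_\tau$ be the set of eigenvalues $\mu$ with $\mathrm{Im}\,\mu>0$ and $|\mu|=\tau$, and let $\Sigma_\tau=\bigoplus_{\mu\in A_\tau}E_{\{\mu,\bar\mu\}}$. If $\tau\in|\mathrm{Spec}(A)|$ is positive and not an eigenvalue of $A$, put $d_\tau=\max_{\mu\in A_\tau}\tfrac12\dim_{\mathbb R}E_{\{\mu,\bar\mu\}}$ (and $d_\tau = 0$ if $A_\tau=\emptyset$). *Coefficients.* Write $\binom{k}{i}=\sum_j c_{i,j}k^j$ as a polynomial in $k$. For $t\in\mathrm{Spec}_{>0}(A)$ and $x\in E_t$ let $$\alpha_{t,j}(x)=\sum_{i=0}^{d_t-1}c_{i,j}\,t^{-i}f\big((A-t)^ix\big)\in\mathbb R ,$$ and for an eigenvalue $\mu$ with $\mathrm{Im}\,\mu>0$ and $x\in\Sigma_{|\mu|}$ let $$a_{\mu,j}(x)=\sum_{i=0}^{d_\mu-1}c_{i,j}\,\mu^{-i}f_{\mathbb C}\big((A_{\mathbb C}-\mu)^i\pi_\mu(x)\big)\in\mathbb C ,$$ where $A_{\mathbb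 C}$, $f_{\mathbb C}$ are the $\mathbb C$-linear extensions to $\mathbb C\otimes_{\mathbb R} E$ and $\pi_\mu$ is the projection onto the generalized eigenspace of $A_{\mathbb C}$ for $\mu$ along the other generalized eigenspaces. These are $\mathbb R$-linear in $x$. *The sets $S_{t,l}$.* For $t\in\mathrm{Spec}_{>0}(A)$ and $0\le l\le d_t-1$ let $S_{t,l}$ be the set of $x\in E$ such that - for every $\tau\in|\mathrm{Spec}(A)|$ with $\tau>t$: if $\tau\notin\mathrm{Spec}(A)$, then $a_{\mu,j}(x_\mu)=0$ for all $\mu\in A_\tau$ and $0\le j\le d_\tau-1$; if $\tau\in\mathrm{Spec}(A)$, then $\alpha_{\tau,i}(x_\tau)=0$ for all $0\le i\le d_\tau-1$; - $\alpha_{t,i}(x_t)=0$ for all $l+1\le i\le d_t-1$; - $\alpha_{t,l}(x_t)>0$. **Theorem.** Assume that every real eigenvalue of $A$ is positive or zero, and that if $t$ is a positive eigenvalue of $A$ then no other complex eigenvalue of $A$ has modulus $t$ (Assumption $(\mathcal H)$). Then: 1. for all $t\in\mathrm{Spec}_{>0}(A)$, $x\in E_t$ and $k\ge 0$, $\; f(A^kx)=\Big(\sum_{i=0}^{d_t-1}\alpha_{t,i}(x)k^i\Big)t^k$;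 2. for all positive $\tau\in|\mathrm{Spec}(A)|\setminus\mathrm{Spec}_{>0}(A)$, $x\in\Sigma_\tau$ and $k\ge 0$, $$f(A^kx)=\Big[\sum_{j=0}^{d_\tau-1}\Big(\sum_{\mu\in A_\tau}a_{\mu,j}(x)u_\mu^k+\overline{a_{\mu,j}(x)u_\mu^k}\Big)k^j\Big]\tau^k,\qquad u_\mu=\mu/\tau;$$ 3. each $S_{t,l}$ is the set of solutions of finitely many homogeneous linear equations and one strict homogeneous linear inequality; 4. the sets $S_{t,l}$, for $t\in\mathrm{Spec}_{>0}(A)$ and $l\in\{0,\dots,d_t-1\}$, are pairwise disjoint and their union is $ANT(P(A,f))$. In particular $ANT(P(A,f))$ is semi-linear, i.e. a finite union of sets each cut out by finitely many linear equalities and strict linear inequalities. (In 1 and 2, $0^0=1$.) -/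

import Mathlib

noncomputable section

namespace LoopANT

open Polynomial
open scoped TensorProduct

variable {E : Type*} [AddCommGroup E] [Module ℝ E]

/-! ### Loop programs `while (f x > 0) { x := A x }` -/

/-- The program `while (f x > 0) { x := A x }` terminates on the input `x`. -/
def TerminatesOn (A : Module.End ℝ E) (f : Module.Dual ℝ E) (x : E) : Prop :=
  ∃ k : ℕ, f ((A ^ k) x) ≤ 0

/-- The set of asymptotically non-terminating inputs: after finitely many updates one reaches an
input on which the program does not terminate. -/
def ANT (A : Module.End ℝ E) (f : Module.Dual ℝ E) : Set E :=
  {x | ∃ k : ℕ, ¬ TerminatesOn A f ((A ^ k) x)}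

/-- A semi-linear subset of `E`: a finite union of sets, each of which is cut out by finitely many
linear equalities and strict linear inequalities. -/
def IsSemilinear (S : Set E) : Prop :=
  ∃ (n : ℕ) (G H : Fin n → Finset (Module.Dual ℝ E)),
    S = ⋃ i, {x | (∀ g ∈ G i, g x = 0) ∧ ∀ h ∈ H i, 0 < h x}

/-! ### Spectrum -/

variable [FiniteDimensional ℝ E]

/-- The finite set of complex eigenvalues of `A` (complex roots of the characteristic
polynomial). -/
def spec (A : Module.End ℝ E) : Finset ℂ :=
  (A.charpoly.aroots ℂ).toFinset

/-- The multiplicity `d_z` of `z` as a root of the characteristic polynomial of `A`. -/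
def mult (A : Module.End ℝ E) (z : ℂ) : ℕ :=
  (A.charpoly.map (algebraMap ℝ ℂ)).rootMultiplicity z

/-- The set of moduli of the complex eigenvalues. -/
def absSpec (A : Module.End ℝ E) : Set ℝ :=
  {τ | ∃ z ∈ spec A, ‖z‖ = τ}

/-- The set of positive real eigenvalues. -/
def posSpec (A : Module.End ℝ E) : Set ℝ :=
  {t | 0 < t ∧ (t : ℂ) ∈ spec A}

/-- `A_τ`: the eigenvalues of modulus `τ` in the open upper half plane. -/
def upperSpec (A : Module.End ℝ E) (τ : ℝ) : Finset ℂ :=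
  {z ∈ spec A | 0 < z.im ∧ ‖z‖ = τ}

/-- The assumption on `A`: every real eigenvalue is positive or zero, and no other complex
eigenvalue has the same modulus as a given positive eigenvalue. -/
structure AssumptionH (A : Module.End ℝ E) : Prop where
  nonneg_of_real : ∀ r : ℝ, (r : ℂ) ∈ spec A → 0 ≤ r
  eq_of_norm_eq : ∀ t ∈ posSpec A, ∀ z ∈ spec A, ‖z‖ = t → z = (t : ℂ)

/-! ### Characteristic subspaces and the decomposition of `E` -/

/-- `A - z` if `z` is real, and `(A - z)(A - conj z) = A² - 2 Re(z) A + |z|²` otherwise. -/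
def charOp (A : Module.End ℝ E) (z : ℂ) : Module.End ℝ E :=
  if z.im = 0 then A - z.re • 1 else A ^ 2 - (2 * z.re) • A + Complex.normSq z • 1

/-- The characteristic subspace: `E_z` if `z` is real and `E_{z, conj z}` otherwise. -/
def charSubspace (A : Module.End ℝ E) (z : ℂ) : Submodule ℝ E :=
  LinearMap.ker (charOp A z ^ mult A z)

/-- The eigenvalues which are real or in the upper half plane; they index the decomposition of `E`
into characteristic subspaces. -/
def indexSpec (A : Module.End ℝ E) : Finset ℂ :=
  {z ∈ spec A | 0 ≤ z.im}

/-- The real polynomial defining `charOp`. -/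
def charFactor (z : ℂ) : ℝ[X] :=
  if z.im = 0 then X - C z.re else X ^ 2 - C (2 * z.re) * X + C (Complex.normSq z)

theorem internal_of_coprime {F : Type*} [AddCommGroup F] [Module ℝ F]
    {ι : Type*} [Fintype ι] [DecidableEq ι]
    (A : Module.End ℝ F) (q : ι → ℝ[X]) (hq : Pairwise (Function.onFun IsCoprime q))
    (h : aeval A (∏ i, q i) = 0) :
    DirectSum.IsInternal fun i => LinearMap.ker (aeval A (q i)) := by
  apply DirectSum.isInternal_submodule_of_iSupIndep_of_iSup_eq_top
  · intro i
    have hc : IsCoprime (q i) (∏ j ∈ Finset.univ.erase i, q j) :=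
      IsCoprime.prod_right fun j hj => hq (Finset.ne_of_mem_erase hj).symm
    refine (disjoint_ker_aeval_of_isCoprime A hc).mono_right ?_
    refine iSup₂_le fun j hj x hx => ?_
    obtain ⟨r, hr⟩ := Finset.dvd_prod_of_mem q (Finset.mem_erase.2 ⟨hj, Finset.mem_univ j⟩)
    rw [LinearMap.mem_ker] at hx ⊢
    rw [hr, mul_comm, map_mul, Module.End.mul_apply, hx, map_zero]
  · have key : ∀ s : Finset ι, LinearMap.ker (aeval A (∏ i ∈ s, q i)) ≤
        ⨆ i, LinearMap.ker (aeval A (q i)) := by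
      intro s
      induction s using Finset.induction_on with
      | empty => intro x hx; simp at hx; simp [hx]
      | insert i s hi ih =>
        rw [Finset.prod_insert hi, ← sup_ker_aeval_eq_ker_aeval_mul_of_coprime A
          (IsCoprime.prod_right fun j hj => hq (fun e => hi (by rw [e]; exact hj)))]
        exact sup_le (le_iSup (fun i => LinearMap.ker (aeval A (q i))) i) ih
    rw [eq_top_iff]
    refine le_trans ?_ (key Finset.univ)
    rw [h]; simp

theorem charFactor_map (z : ℂ) : (charFactor z).map (algebraMap ℝ ℂ) =
    if z.im = 0 then X - C z else (X - C z) * (X - C ((starRingEnd ℂ) z)) := by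
  unfold charFactor
  split_ifs with h
  · have : (z.re : ℂ) = z := Complex.ext (by simp) (by simp [h])
    simp [this]
  · have h1 : ((2 * z.re : ℝ) : ℂ) = z + (starRingEnd ℂ) z := by
      rw [Complex.add_conj]
    have h2 : ((Complex.normSq z : ℝ) : ℂ) = z * (starRingEnd ℂ) z := by
      rw [Complex.mul_conj]
    simp only [Polynomial.map_add, Polynomial.map_sub, Polynomial.map_mul, Polynomial.map_pow,
      map_X, map_C, Complex.coe_algebraMap, h1, h2]
    simp only [C_add, C_mul]
    ring

theorem charFactor_coprime {z w : ℂ} (hz : 0 ≤ z.im) (hw : 0 ≤ w.im) (h : z ≠ w) :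
    IsCoprime (charFactor z) (charFactor w) := by
  rw [← Polynomial.isCoprime_map (algebraMap ℝ ℂ), charFactor_map, charFactor_map]
  have key : ∀ a b : ℂ, a ≠ b → IsCoprime (X - C a) (X - C b) := fun a b hab =>
    Polynomial.isCoprime_X_sub_C_of_isUnit_sub (sub_ne_zero.2 hab).isUnit
  have k1 : z.im ≠ 0 → (starRingEnd ℂ) z ≠ w := fun h1 e => by
    have := congrArg Complex.im e
    simp at this
    exact h1 (by linarith)
  have k2 : w.im ≠ 0 → z ≠ (starRingEnd ℂ) w := fun h1 e => by
    have := congrArg Complex.im e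
    simp at this
    exact h1 (by linarith)
  have k3 : (starRingEnd ℂ) z ≠ (starRingEnd ℂ) w := fun e => h (star_injective e)
  split_ifs with h1 h2 h2
  · exact key _ _ h
  · exact IsCoprime.mul_right (key _ _ h) (key _ _ (k2 h2))
  · exact IsCoprime.mul_left (key _ _ h) (key _ _ (k1 h1))
  · exact IsCoprime.mul_left (IsCoprime.mul_right (key _ _ h) (key _ _ (k2 h2)))
      (IsCoprime.mul_right (key _ _ (k1 h1)) (key _ _ k3))

theorem dvd_prod_charFactor (p : ℝ[X]) (hp : p.Monic) :
    p ∣ ∏ z ∈ (p.aroots ℂ).toFinset.filter (fun z => 0 ≤ z.im),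
      charFactor z ^ (p.map (algebraMap ℝ ℂ)).rootMultiplicity z := by
  rw [← Polynomial.map_dvd_map' (algebraMap ℝ ℂ)]
  have hm : (p.map (algebraMap ℝ ℂ)).Monic := hp.map _
  have hs := (IsAlgClosed.splits (p.map (algebraMap ℝ ℂ))).eq_prod_roots_of_monic hm
  have hconj : ∀ z, (p.map (algebraMap ℝ ℂ)).rootMultiplicity ((starRingEnd ℂ) z) =
      (p.map (algebraMap ℝ ℂ)).rootMultiplicity z := by
    intro z
    have := Polynomial.eq_rootMultiplicity_map (p := p.map (algebraMap ℝ ℂ))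
      (f := starRingEnd ℂ) (RingHom.injective _) z
    rw [this, Polynomial.map_map]
    congr 2
    ext x; simp
  conv_lhs => rw [hs]
  rw [Finset.prod_multiset_map_count]
  rw [Polynomial.map_prod]
  set R := (p.aroots ℂ).toFinset
  have hR : (p.map (algebraMap ℝ ℂ)).roots.toFinset = R := rfl
  have hRc : ∀ z ∈ R, (starRingEnd ℂ) z ∈ R := by
    intro z hz
    rw [← hR, Multiset.mem_toFinset, ← Multiset.count_pos, count_roots] at hz ⊢
    rwa [hconj]
  simp only [Polynomial.map_pow, charFactor_map, count_roots]
  rw [← Finset.prod_filter_mul_prod_filter_not R (fun z => 0 ≤ z.im)]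
  have e : ∏ z ∈ R with ¬ 0 ≤ z.im,
      (X - C z) ^ (p.map (algebraMap ℝ ℂ)).rootMultiplicity z =
      ∏ z ∈ R with 0 < z.im,
      (X - C ((starRingEnd ℂ) z)) ^ (p.map (algebraMap ℝ ℂ)).rootMultiplicity z := by
    refine Finset.prod_bij' (fun z _ => (starRingEnd ℂ) z) (fun z _ => (starRingEnd ℂ) z)
      ?_ ?_ ?_ ?_ ?_
    · intro z hz; simp only [Finset.mem_filter, not_le] at hz ⊢
      exact ⟨hRc _ hz.1, by simpa using hz.2⟩
    · intro z hz; simp only [Finset.mem_filter, not_le] at hz ⊢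
      exact ⟨hRc _ hz.1, by simpa using hz.2⟩
    · simp
    · simp
    · intro z hz; rw [hconj]; simp
  have e2 : ∏ z ∈ R with 0 < z.im,
      (X - C ((starRingEnd ℂ) z)) ^ (p.map (algebraMap ℝ ℂ)).rootMultiplicity z =
      ∏ z ∈ R with 0 ≤ z.im, (if z.im = 0 then 1 else (X - C ((starRingEnd ℂ) z)) ^
        (p.map (algebraMap ℝ ℂ)).rootMultiplicity z) := by
    rw [Finset.prod_ite, Finset.prod_const_one, one_mul, Finset.filter_filter]
    refine Finset.prod_congr ?_ fun _ _ => rfl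
    ext z
    simp only [Finset.mem_filter]
    constructor
    · rintro ⟨h, h'⟩; exact ⟨h, h'.le, h'.ne'⟩
    · rintro ⟨h, h', h''⟩; exact ⟨h, lt_of_le_of_ne h' (Ne.symm h'')⟩
  rw [e, e2, ← Finset.prod_mul_distrib]
  refine dvd_of_eq (Finset.prod_congr rfl fun z _ => ?_)
  split_ifs <;> simp [mul_pow]

theorem charSubspace_eq_ker_aeval (A : Module.End ℝ E) (z : ℂ) :
    charSubspace A z = LinearMap.ker (aeval A (charFactor z ^ mult A z)) := by
  have h : aeval A (charFactor z) = charOp A z := by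
    unfold charFactor charOp
    split_ifs <;> simp [Algebra.algebraMap_eq_smul_one, smul_smul, mul_comm]
  rw [charSubspace, map_pow, h]

/-- `E` is the internal direct sum of the characteristic subspaces. -/
theorem isInternal_charSubspace (A : Module.End ℝ E) :
    DirectSum.IsInternal fun z : indexSpec A => charSubspace A (z : ℂ) := by
  simp only [charSubspace_eq_ker_aeval]
  refine internal_of_coprime A (fun z : indexSpec A => charFactor (z : ℂ) ^ mult A z) ?_ ?_
  · intro z w hzw
    have hz := (Finset.mem_filter.1 z.2).2
    have hw := (Finset.mem_filter.1 w.2).2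
    exact (charFactor_coprime hz hw fun e => hzw (Subtype.ext e)).pow
  · obtain ⟨r, hr⟩ := dvd_prod_charFactor A.charpoly A.charpoly_monic
    have h2 : ∏ z : indexSpec A, charFactor (z : ℂ) ^ mult A z = A.charpoly * r := by
      rw [← hr]
      exact Finset.prod_coe_sort (indexSpec A) fun z => charFactor z ^ mult A z
    rw [h2, map_mul, A.aeval_self_charpoly, zero_mul]

/-- The projection of a module onto the `i`-th summand of an internal direct sum, along the other
summands. -/
def summandProj {R M ι : Type*} [CommRing R] [AddCommGroup M] [Module R M] [DecidableEq ι]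
    (V : ι → Submodule R M) (hV : DirectSum.IsInternal V) (i : ι) : M →ₗ[R] M :=
  (V i).subtype ∘ₗ DirectSum.component R ι (fun j => V j) i ∘ₗ
    (LinearEquiv.ofBijective (DirectSum.coeLinearMap V) hV).symm.toLinearMap

/-- The component `x_z` of `x` in the characteristic subspace of the eigenvalue `z`, with respect
to the decomposition of `E` into characteristic subspaces (and `0` if `z` is not one of the
indices of that decomposition). -/
def comp (A : Module.End ℝ E) (z : ℂ) : E →ₗ[ℝ] E :=
  if h : z ∈ indexSpec A then
    summandProj (fun w : indexSpec A => charSubspace A (w : ℂ)) (isInternal_charSubspace A) ⟨z, h⟩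
  else 0

/-! ### The coefficients of `f (A ^ k x)` -/

/-- `Σ_τ`: the sum of the subspaces `E_{μ, conj μ}` over the upper half plane eigenvalues `μ` of
modulus `τ`. -/
def sigmaSpace (A : Module.End ℝ E) (τ : ℝ) : Submodule ℝ E :=
  ⨆ μ ∈ upperSpec A τ, charSubspace A μ

/-- `d_τ` for a modulus `τ` which is not an eigenvalue: the maximum of `dim E_{μ, conj μ} / 2` over
the upper half plane eigenvalues `μ` of modulus `τ`. -/
def maxHalfDim (A : Module.End ℝ E) (τ : ℝ) : ℕ :=
  (upperSpec A τ).sup fun μ => Module.finrank ℝ (charSubspace A μ) / 2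

/-- The coefficient of `k ^ j` in the binomial coefficient `k.choose i`, viewed as a polynomial
in `k`. -/
def chooseCoeff (i j : ℕ) : ℝ :=
  (descPochhammer ℝ i).coeff j / (i.factorial : ℝ)

/-- The linear form `α_{t,j}`, to be applied to elements of `E_t`. There
`f (A ^ k x) = ∑ i < d_t, (k.choose i) t ^ (k - i) f ((A - t) ^ i x)`; dividing by `t ^ k` and
expanding the binomial coefficients gives the coefficient of `k ^ j`. -/
def alpha (A : Module.End ℝ E) (f : Module.Dual ℝ E) (t : ℝ) (j : ℕ) : E →ₗ[ℝ] ℝ :=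
  ∑ i ∈ Finset.range (mult A (t : ℂ)),
    (chooseCoeff i j * (t ^ i)⁻¹) • (f ∘ₗ (A - t • (1 : Module.End ℝ E)) ^ i)

theorem isInternal_maxGenEigenspace {V : Type*} [AddCommGroup V] [Module ℂ V]
    [FiniteDimensional ℂ V] (B : Module.End ℂ V) :
    DirectSum.IsInternal fun z => B.maxGenEigenspace z :=
  DirectSum.isInternal_submodule_of_iSupIndep_of_iSup_eq_top
    B.independent_maxGenEigenspace B.iSup_maxGenEigenspace_eq_top

/-- The `ℂ`-linear extension of `f` to the complexification of `E`. -/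
def complexForm (f : Module.Dual ℝ E) : (ℂ ⊗[ℝ] E) →ₗ[ℂ] ℂ :=
  (TensorProduct.AlgebraTensorModule.rid ℝ ℂ ℂ).toLinearMap ∘ₗ LinearMap.baseChange ℂ f

/-- The projection of `x : E` to the generalized eigenspace of `z` in the complexification of `E`,
along the other generalized eigenspaces of the `ℂ`-linear extension of `A`. -/
def complexComp (A : Module.End ℝ E) (z : ℂ) : E →ₗ[ℝ] ℂ ⊗[ℝ] E :=
  (summandProj _ (isInternal_maxGenEigenspace (A.baseChange ℂ)) z).restrictScalars ℝ ∘ₗ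
    TensorProduct.mk ℝ ℂ E 1

/-- The linear map `a_{μ,j}`, to be applied to elements of `Σ_τ` with `τ = |μ|`. It is the analogue
of `alpha` on the complexification: an element `x` of `E_{μ, conj μ}` is the sum of its component
`w` in the generalized eigenspace of `μ` and of the conjugate of `w`, and
`f (A ^ k w) = ∑ i < d_μ, (k.choose i) μ ^ (k - i) f ((A - μ) ^ i w)`. -/
def aCoeff (A : Module.End ℝ E) (f : Module.Dual ℝ E) (μ : ℂ) (j : ℕ) : E →ₗ[ℝ] ℂ :=
  ∑ i ∈ Finset.range (mult A μ),
    ((chooseCoeff i j : ℂ) * (μ ^ i)⁻¹) •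
      ((complexForm f ∘ₗ
        (A.baseChange ℂ - μ • (1 : Module.End ℂ (ℂ ⊗[ℝ] E))) ^ i).restrictScalars ℝ ∘ₗ
          complexComp A μ)

/-! ### The sets `S_{t,l}` -/

/-- The index set of pairs `(t, l)` with `t` a positive eigenvalue and `0 ≤ l ≤ d_t - 1`. -/
def deltaS (A : Module.End ℝ E) : Set (ℝ × ℕ) :=
  {p | p.1 ∈ posSpec A ∧ p.2 < mult A (p.1 : ℂ)}

/-- The set `S_{t,l}`. -/
def setS (A : Module.End ℝ E) (f : Module.Dual ℝ E) (t : ℝ) (l : ℕ) : Set E :=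
  {x | (∀ τ ∈ absSpec A, t < τ →
          ((τ : ℂ) ∉ spec A →
            ∀ μ ∈ upperSpec A τ, ∀ j < maxHalfDim A τ, aCoeff A f μ j (comp A μ x) = 0) ∧
          ((τ : ℂ) ∈ spec A →
            ∀ i < mult A (τ : ℂ), alpha A f τ i (comp A (τ : ℂ) x) = 0)) ∧
       (∀ i, l < i → i < mult A (t : ℂ) → alpha A f t i (comp A (t : ℂ) x) = 0) ∧
       0 < alpha A f t l (comp A (t : ℂ) x)}

end LoopANT

end

/-!
The input `x` is asymptotically non-terminating exactly when `f (A ^ k x)` is positive for all large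
`k`, so everything rests on the behaviour of this real sequence.

In the complexification, `1 ⊗ x` is the sum of its components in the generalized eigenspaces of `A`,
and the binomial expansion of `A ^ k = (z + (A - z)) ^ k` on the one belonging to `z ≠ 0` shows that
it contributes `(∑ j, aCoeff A f z j x * k ^ j) * z ^ k` (`complexForm_pow_complexComp`). The
coefficients `aCoeff A f z j x` are used uniformly for all complex eigenvalues: for a real
eigenvalue they reduce to `alpha` (`aCoeff_real`), conjugate eigenvalues have conjugate coefficients
(`aCoeff_conj`), and the coefficients with `d_z ≤ j` vanish. Since `E_{μ, conj μ}` has dimension at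
least `2 d_μ` (`mult_le_half_finrank`), the range `j < d_τ` sees all nonzero coefficients. This
gives the closed forms on `E_t` and on `Σ_τ`, and for large `k`, when the eigenvalue `0` has died out,
it presents `f (A ^ k x)` as an exponential polynomial.

Order the pairs (modulus, degree) lexicographically and let `(τ, l)` be the largest one with a
nonzero coefficient. After division by `k ^ l * τ ^ k` only the terms at `(τ, l)` survive
(`tendsto_expPoly_sub`). If `τ` is an eigenvalue, it is by assumption the only one of its modulus,
so the sequence is eventually positive exactly when the coefficient at `(τ, l)` is positive, that
is, when `x ∈ S_{τ,l}`. If `τ` is not an eigenvalue, the surviving part is a combination of powers of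
points `u ≠ 1` of the unit circle; such a combination has mean zero, and it cannot be asymptotically
nonnegative unless it vanishes (`coeff_eq_zero_of_nonneg`). The sets `S_{t,l}` are disjoint because
the dominant pair is determined by `x`.
-/

namespace LoopANT

open Polynomial Filter Topology
open scoped TensorProduct

/-! ### Asymptotics of exponential polynomials -/

/-- The Cesàro mean of the powers of `u ≠ 1` on the unit circle tends to zero, because their partial
sums stay bounded. -/
theorem tendsto_mean_pow {u : ℂ} (hu : ‖u‖ = 1) (h1 : u ≠ 1) :
    Tendsto (fun n : ℕ => (n : ℝ)⁻¹ • ∑ k ∈ Finset.range n, u ^ k) atTop (𝓝 0) := by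
  have hb : ∀ n : ℕ, ‖∑ k ∈ Finset.range n, u ^ k‖ ≤ 2 / ‖u - 1‖ := by
    intro n
    rw [geom_sum_eq h1, norm_div]
    gcongr
    calc ‖u ^ n - 1‖ ≤ ‖u ^ n‖ + ‖(1 : ℂ)‖ := norm_sub_le _ _
      _ = 2 := by simp [hu]; norm_num
  have h0 : Tendsto (fun n : ℕ => (n : ℝ)⁻¹ * (2 / ‖u - 1‖)) atTop (𝓝 0) := by
    simpa using (tendsto_inv_atTop_nhds_zero_nat (𝕜 := ℝ)).mul_const (2 / ‖u - 1‖)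
  refine squeeze_zero_norm (fun n => ?_) h0
  rw [norm_smul, norm_inv, Real.norm_natCast]
  exact mul_le_mul_of_nonneg_left (hb n) (by positivity)

/-- An asymptotically nonnegative combination of powers of points `u ≠ 1` of the unit circle has
all coefficients zero: its mean is zero, hence so is the mean of its absolute value, and the latter
bounds the mean of its product with any character of modulus one. -/
theorem coeff_eq_zero_of_nonneg (U : Finset ℂ) (c : ℂ → ℂ) (hU : ∀ u ∈ U, ‖u‖ = 1 ∧ u ≠ 1)
    (r : ℕ → ℝ) (hr : ∀ᶠ k in atTop, 0 ≤ r k)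
    (h : Tendsto (fun k : ℕ => (r k : ℂ) - ∑ u ∈ U, c u * u ^ k) atTop (𝓝 0)) :
    ∀ u ∈ U, c u = 0 := by
  have mean : ∀ (s : ℕ → ℂ), Tendsto (fun k => s k - ∑ u ∈ U, c u * u ^ k) atTop (𝓝 0) →
      ∀ v : ℂ, ‖v‖ = 1 →
      Tendsto (fun n : ℕ => (n : ℝ)⁻¹ • ∑ k ∈ Finset.range n, s k * v ^ k) atTop
        (𝓝 (∑ u ∈ U, c u * (if u * v = 1 then 1 else 0))) := by
    intro s hs v hv
    have e1 : Tendsto (fun k => (s k - ∑ u ∈ U, c u * u ^ k) * v ^ k) atTop (𝓝 0) := by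
      rw [tendsto_zero_iff_norm_tendsto_zero] at hs ⊢
      simpa [hv] using hs
    have e2 := e1.cesaro_smul
    have e3 : Tendsto (fun n : ℕ => ∑ u ∈ U, c u * ((n : ℝ)⁻¹ • ∑ k ∈ Finset.range n, (u * v) ^ k))
        atTop (𝓝 (∑ u ∈ U, c u * (if u * v = 1 then 1 else 0))) := by
      refine tendsto_finsetSum _ fun u hu => Tendsto.const_mul _ ?_
      split_ifs with huv
      · refine tendsto_const_nhds.congr' ?_
        filter_upwards [eventually_gt_atTop 0] with n hn
        have : (n : ℂ) ≠ 0 := by exact_mod_cast hn.ne'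
        simp [huv, this]
      · exact tendsto_mean_pow (by rw [norm_mul, (hU u hu).1, hv, one_mul]) huv
    have := e2.add e3
    rw [zero_add] at this
    refine this.congr fun n => ?_
    have : ∑ u ∈ U, c u * ((n : ℝ)⁻¹ • ∑ k ∈ Finset.range n, (u * v) ^ k) =
        (n : ℝ)⁻¹ • ∑ k ∈ Finset.range n, (∑ u ∈ U, c u * u ^ k) * v ^ k := by
      simp only [Complex.real_smul, Finset.sum_mul, Finset.mul_sum]
      rw [Finset.sum_comm]
      exact Finset.sum_congr rfl fun k _ => Finset.sum_congr rfl fun u _ => by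
        rw [mul_pow]; ring
    rw [this, ← smul_add, ← Finset.sum_add_distrib]
    congr 1
    exact Finset.sum_congr rfl fun k _ => by ring
  -- The mean of `r` tends to zero, because `1` is not in `U`.
  have m1 : Tendsto (fun n : ℕ => (n : ℝ)⁻¹ • ∑ k ∈ Finset.range n, (r k : ℂ)) atTop (𝓝 0) := by
    have := mean _ h 1 (by simp)
    rw [Finset.sum_eq_zero] at this
    · simpa using this
    · intro u hu
      simp [(hU u hu).2]
  have m2 : Tendsto (fun n : ℕ => (n : ℝ)⁻¹ * ∑ k ∈ Finset.range n, r k) atTop (𝓝 0) := by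
    have := (Complex.continuous_re.tendsto 0).comp m1
    refine (this.congr fun n => ?_)
    simp [← Complex.ofReal_sum]
  -- Since `r` is eventually nonnegative, the mean of its absolute value tends to zero as well.
  have m3 : Tendsto (fun n : ℕ => (n : ℝ)⁻¹ * ∑ k ∈ Finset.range n, |r k|) atTop (𝓝 0) := by
    have z : Tendsto (fun k => |r k| - r k) atTop (𝓝 0) := by
      refine tendsto_const_nhds.congr' ?_
      filter_upwards [hr] with k hk
      rw [abs_of_nonneg hk, sub_self]
    have := z.cesaro.add m2
    rw [zero_add] at this
    refine this.congr fun n => ?_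
    rw [Finset.sum_sub_distrib]; ring
  intro u hu
  have hu1 := (hU u hu).1
  have hu0 : u ≠ 0 := fun h => by simp [h] at hu1
  have m4 := mean _ h u⁻¹ (by simp [hu1])
  have e : ∑ w ∈ U, c w * (if w * u⁻¹ = 1 then 1 else 0) = c u := by
    rw [Finset.sum_eq_single u]
    · simp [hu0]
    · intro w _ hw
      rw [if_neg, mul_zero]
      rwa [mul_inv_eq_one₀ hu0]
    · exact fun h => absurd hu h
  rw [e] at m4
  refine tendsto_nhds_unique m4 (squeeze_zero_norm (fun n => ?_) m3)
  rw [norm_smul, norm_inv, Real.norm_natCast]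
  refine mul_le_mul_of_nonneg_left ((norm_sum_le _ _).trans (Finset.sum_le_sum fun k _ => ?_))
    (by positivity)
  simp [hu1]

/-- Values at `k` of the exponential polynomial with coefficient `c z j` at `k ^ j * z ^ k`. -/
def expPoly (S : Finset ℂ) (n : ℕ) (c : ℂ → ℕ → ℂ) (k : ℕ) : ℂ :=
  ∑ z ∈ S, ∑ j ∈ Finset.range n, c z j * (k : ℂ) ^ j * z ^ k

/-- If the pair `(τ, l)` is lexicographically at least every pair `(‖z‖, j)` carrying a nonzero
coefficient, then the exponential polynomial is, up to `o(k ^ l * τ ^ k)`, the sum of its terms at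
`(τ, l)`. -/
theorem tendsto_expPoly_sub (S : Finset ℂ) (n : ℕ) (c : ℂ → ℕ → ℂ) {τ : ℝ} (hτ : 0 < τ) {l : ℕ}
    (hl : l < n) (h1 : ∀ z ∈ S, τ < ‖z‖ → ∀ j < n, c z j = 0)
    (h2 : ∀ z ∈ S, ‖z‖ = τ → ∀ j < n, l < j → c z j = 0) :
    Tendsto (fun k : ℕ => expPoly S n c k / ((k : ℂ) ^ l * (τ : ℂ) ^ k) -
      ∑ z ∈ S with ‖z‖ = τ, c z l * (z / τ) ^ k) atTop (𝓝 0) := by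
  have hτ' : (τ : ℂ) ≠ 0 := by exact_mod_cast hτ.ne'
  have term : ∀ z ∈ S, ∀ j ∈ Finset.range n, Tendsto (fun k : ℕ =>
      c z j * (k : ℂ) ^ j * z ^ k / ((k : ℂ) ^ l * (τ : ℂ) ^ k) -
        if ‖z‖ = τ ∧ j = l then c z l * (z / τ) ^ k else 0) atTop (𝓝 0) := by
    intro z hz j hj
    rw [Finset.mem_range] at hj
    rcases lt_trichotomy τ ‖z‖ with hlt | heq | hgt
    · have : ¬ (‖z‖ = τ) := hlt.ne'
      simp [h1 z hz hlt j hj, this]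
    · rcases lt_trichotomy l j with hlj | rfl | hlj
      · simp [h2 z hz heq.symm j hj hlj, hlj.ne']
      · refine tendsto_const_nhds.congr' ?_
        filter_upwards [eventually_gt_atTop 0] with k hk
        have hk' : (k : ℂ) ≠ 0 := by exact_mod_cast hk.ne'
        rw [if_pos ⟨heq.symm, rfl⟩, div_pow]
        field_simp
        simp
      · simp only [hlj.ne, and_false, if_false, sub_zero]
        have h0 : Tendsto (fun k : ℕ => ‖c z j‖ * ((k : ℝ))⁻¹) atTop (𝓝 0) := by
          simpa using (tendsto_inv_atTop_nhds_zero_nat (𝕜 := ℝ)).const_mul ‖c z j‖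
        refine squeeze_zero_norm' ?_ h0
        filter_upwards [eventually_gt_atTop 0] with k hk
        have hk' : (0 : ℝ) < k := by exact_mod_cast hk
        have hk1 : (1 : ℝ) ≤ k := by exact_mod_cast hk
        simp only [norm_div, norm_mul, norm_pow, ← heq, Complex.norm_natCast, Complex.norm_real,
          Real.norm_of_nonneg hτ.le]
        rw [mul_div_mul_right _ _ (by positivity), mul_div_assoc]
        refine mul_le_mul_of_nonneg_left ?_ (norm_nonneg _)
        rw [div_le_iff₀ (by positivity), inv_mul_eq_div, le_div_iff₀ hk', ← pow_succ]
        exact pow_le_pow_right₀ hk1 hlj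
    · have : ¬ (‖z‖ = τ) := hgt.ne
      simp only [this, false_and, if_false, sub_zero]
      have h0 : Tendsto (fun k : ℕ => ‖c z j‖ * ((k : ℝ) ^ j * (‖z‖ / τ) ^ k)) atTop (𝓝 0) := by
        simpa using (tendsto_pow_const_mul_const_pow_of_lt_one j (r := ‖z‖ / τ) (by positivity)
          ((div_lt_one hτ).2 hgt)).const_mul ‖c z j‖
      refine squeeze_zero_norm' ?_ h0
      filter_upwards [eventually_gt_atTop 0] with k hk
      have hk1 : (1 : ℝ) ≤ k := by exact_mod_cast hk
      simp only [norm_div, norm_mul, norm_pow, Complex.norm_natCast, Complex.norm_real,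
        Real.norm_of_nonneg hτ.le]
      rw [mul_assoc, mul_div_assoc]
      refine mul_le_mul_of_nonneg_left ?_ (norm_nonneg _)
      rw [div_pow, ← mul_div_assoc]
      refine div_le_div_of_nonneg_left (by positivity) (by positivity) ?_
      exact le_mul_of_one_le_left (by positivity) (one_le_pow₀ hk1)
  have := tendsto_finsetSum S fun z hz => tendsto_finsetSum (Finset.range n) (term z hz)
  simp only [Finset.sum_const_zero] at this
  refine this.congr fun k => ?_
  simp only [Finset.sum_sub_distrib, expPoly, Finset.sum_div]
  congr 1
  rw [Finset.sum_filter]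
  refine Finset.sum_congr rfl fun z _ => ?_
  split_ifs with hz
  · simp [hz, hl]
  · simp [hz]

/-- A real sequence given by an exponential polynomial whose dominant term is a real one, with
positive coefficient, is eventually positive. -/
theorem eventually_pos_of_dominant (S : Finset ℂ) (n : ℕ) (c : ℂ → ℕ → ℂ) (g : ℕ → ℝ)
    (hg : ∀ᶠ k in atTop, (g k : ℂ) = expPoly S n c k)
    {t : ℝ} (ht : 0 < t) {l : ℕ} (hl : l < n) (htS : (t : ℂ) ∈ S)
    (huniq : ∀ z ∈ S, ‖z‖ = t → z = t)
    (h1 : ∀ z ∈ S, t < ‖z‖ → ∀ j < n, c z j = 0)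
    (h2 : ∀ j < n, l < j → c t j = 0) (h3 : 0 < (c t l).re) :
    ∀ᶠ k in atTop, 0 < g k := by
  have lim := tendsto_expPoly_sub S n c ht hl h1
    (fun z hz hzt => by rw [huniq z hz hzt]; exact h2)
  have hf : S.filter (fun z => ‖z‖ = t) = {(t : ℂ)} := by
    ext z
    simp only [Finset.mem_filter, Finset.mem_singleton]
    refine ⟨fun h => huniq z h.1 h.2, ?_⟩
    rintro rfl
    exact ⟨htS, by simp [ht.le]⟩
  have ht' : (t : ℂ) ≠ 0 := by exact_mod_cast ht.ne'
  simp only [hf, Finset.sum_singleton, div_self ht', one_pow, mul_one] at lim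
  have lim2 : Tendsto (fun k : ℕ => g k / ((k : ℝ) ^ l * t ^ k)) atTop (𝓝 (c t l).re) := by
    have := (Complex.continuous_re.tendsto _).comp (lim.add_const (c t l))
    rw [zero_add] at this
    refine this.congr' ?_
    filter_upwards [hg] with k hk
    simp only [Function.comp_apply, sub_add_cancel, ← hk]
    exact_mod_cast Complex.ofReal_re _
  filter_upwards [lim2.eventually (lt_mem_nhds h3)] with k hk
  by_contra hneg
  exact absurd hk (not_lt.2 (div_nonpos_of_nonpos_of_nonneg (not_lt.1 hneg) (by positivity)))

/-- If a real sequence given by an exponential polynomial is eventually positive, then its dominant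
term is a real one, with positive coefficient. -/
theorem exists_dominant_of_eventually_pos (S : Finset ℂ) (n : ℕ) (c : ℂ → ℕ → ℂ) (g : ℕ → ℝ)
    (h0 : (0 : ℂ) ∉ S) (hg : ∀ᶠ k in atTop, (g k : ℂ) = expPoly S n c k)
    (huniq : ∀ t : ℝ, (t : ℂ) ∈ S → ∀ z ∈ S, ‖z‖ = t → z = t)
    (hpos : ∀ᶠ k in atTop, 0 < g k) :
    ∃ t : ℝ, (t : ℂ) ∈ S ∧ ∃ l < n, (∀ z ∈ S, t < ‖z‖ → ∀ j < n, c z j = 0) ∧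
      (∀ j < n, l < j → c t j = 0) ∧ 0 < (c t l).re := by
  classical
  -- The pairs `(z, j)` with a nonzero coefficient.
  let T : Finset (ℂ × ℕ) := (S ×ˢ Finset.range n).filter fun p => c p.1 p.2 ≠ 0
  have hT : ∀ z ∈ S, ∀ j < n, c z j ≠ 0 → (z, j) ∈ T := fun z hz j hj h => by
    simp [T, hz, hj, h]
  have hne : T.Nonempty := by
    by_contra hT0
    rw [Finset.not_nonempty_iff_eq_empty] at hT0
    obtain ⟨k, hk1, hk2⟩ := (hg.and hpos).exists
    have : expPoly S n c k = 0 := Finset.sum_eq_zero fun z hz => Finset.sum_eq_zero fun j hj => by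
      by_contra h
      have := hT z hz j (Finset.mem_range.1 hj) (fun h' => h (by simp [h']))
      simp [hT0] at this
    rw [this] at hk1
    exact hk2.ne' (by exact_mod_cast hk1)
  obtain ⟨⟨w, l⟩, hw, hmax⟩ := T.exists_max_image (fun p => toLex (‖p.1‖, p.2)) hne
  obtain ⟨⟨hwS, hl⟩, hwl⟩ : (w ∈ S ∧ l < n) ∧ c w l ≠ 0 := by simpa [T] using hw
  have hτ : 0 < ‖w‖ := norm_pos_iff.2 fun h => h0 (h ▸ hwS)
  have h1 : ∀ z ∈ S, ‖w‖ < ‖z‖ → ∀ j < n, c z j = 0 := by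
    intro z hz hlt j hj
    by_contra h
    have := hmax _ (hT z hz j hj h)
    rw [Prod.Lex.toLex_le_toLex] at this
    rcases this with h | h
    · exact absurd h (not_lt.2 hlt.le)
    · exact absurd h.1 hlt.ne'
  have h2 : ∀ z ∈ S, ‖z‖ = ‖w‖ → ∀ j < n, l < j → c z j = 0 := by
    intro z hz he j hj hlj
    by_contra h
    have := hmax _ (hT z hz j hj h)
    rw [Prod.Lex.toLex_le_toLex] at this
    rcases this with h | h
    · exact absurd he h.ne
    · exact absurd h.2 (not_le.2 hlj)
  have lim := tendsto_expPoly_sub S n c hτ hl h1 h2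
  let r : ℕ → ℝ := fun k => g k / ((k : ℝ) ^ l * ‖w‖ ^ k)
  have hr : ∀ᶠ k in atTop, 0 ≤ r k := by
    filter_upwards [hpos] with k hk
    positivity
  have lim2 : Tendsto (fun k : ℕ => (r k : ℂ) -
      ∑ z ∈ S with ‖z‖ = ‖w‖, c z l * (z / ‖w‖) ^ k) atTop (𝓝 0) := by
    refine lim.congr' ?_
    filter_upwards [hg] with k hk
    simp [r, hk]
  have hw' : ((‖w‖ : ℝ) : ℂ) ≠ 0 := by exact_mod_cast hτ.ne'
  by_cases hreal : ((‖w‖ : ℝ) : ℂ) ∈ S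
  · have hwe : w = (‖w‖ : ℝ) := huniq _ hreal w hwS rfl
    refine ⟨‖w‖, hreal, l, hl, h1, h2 _ hreal (by simp), ?_⟩
    have hf : S.filter (fun z => ‖z‖ = ‖w‖) = {((‖w‖ : ℝ) : ℂ)} := by
      ext z
      simp only [Finset.mem_filter, Finset.mem_singleton]
      refine ⟨fun h => huniq _ hreal z h.1 h.2, ?_⟩
      rintro rfl
      exact ⟨hreal, by simp⟩
    simp only [hf, Finset.sum_singleton, div_self hw', one_pow, mul_one] at lim2
    have lim3 := lim2.add_const (c (‖w‖ : ℝ) l)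
    simp only [sub_add_cancel, zero_add] at lim3
    have hre : 0 ≤ (c (‖w‖ : ℝ) l).re :=
      ge_of_tendsto ((Complex.continuous_re.tendsto _).comp lim3) (by simpa using hr)
    have him : (c (‖w‖ : ℝ) l).im = 0 :=
      tendsto_nhds_unique ((Complex.continuous_im.tendsto _).comp lim3)
        (tendsto_const_nhds.congr fun k => by simp)
    refine lt_of_le_of_ne hre fun h => hwl ?_
    rw [hwe]
    exact Complex.ext h.symm him
  · exfalso
    let U : Finset ℂ := (S.filter fun z => ‖z‖ = ‖w‖).image fun z => z / (‖w‖ : ℝ)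
    have hU : ∀ u ∈ U, ‖u‖ = 1 ∧ u ≠ 1 := by
      intro u hu
      obtain ⟨z, hz, rfl⟩ := Finset.mem_image.1 hu
      rw [Finset.mem_filter] at hz
      refine ⟨by simp [hz.2, hτ.ne'], fun h => hreal ?_⟩
      rw [div_eq_one_iff_eq hw'] at h
      rw [← h]; exact hz.1
    have lim3 : Tendsto (fun k : ℕ => (r k : ℂ) -
        ∑ u ∈ U, c (u * (‖w‖ : ℝ)) l * u ^ k) atTop (𝓝 0) := by
      refine lim2.congr fun k => ?_
      rw [Finset.sum_image fun a _ b _ h => (div_left_inj' hw').1 h]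
      refine congrArg _ (Finset.sum_congr rfl fun z _ => ?_)
      rw [div_mul_cancel₀ _ hw']
    have := coeff_eq_zero_of_nonneg U _ hU r hr lim3 (w / (‖w‖ : ℝ))
      (Finset.mem_image_of_mem _ (by simp [hwS]))
    rw [div_mul_cancel₀ _ hw'] at this
    exact hwl this

/-! ### Projections of an internal direct sum -/

section SummandProj

variable {R M ι : Type*} [CommRing R] [AddCommGroup M] [Module R M] [DecidableEq ι]
  {V : ι → Submodule R M}

theorem summandProj_mem (hV : DirectSum.IsInternal V) (i : ι) (v : M) :
    summandProj V hV i v ∈ V i :=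
  Subtype.coe_prop _

theorem summandProj_of_mem (hV : DirectSum.IsInternal V) {i : ι} {v : M} (hv : v ∈ V i) :
    summandProj V hV i v = v := by
  have := hV.ofBijective_coeLinearMap_of_mem hv
  exact congrArg Subtype.val this

theorem summandProj_of_mem_ne (hV : DirectSum.IsInternal V) {i j : ι} (hij : i ≠ j) {v : M}
    (hv : v ∈ V i) : summandProj V hV j v = 0 := by
  have := hV.ofBijective_coeLinearMap_of_mem_ne hij hv
  exact congrArg Subtype.val this

theorem induction_of_isInternal (hV : DirectSum.IsInternal V) {P : M → Prop} (v : M)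
    (mem : ∀ i, ∀ v ∈ V i, P v) (add : ∀ v w, P v → P w → P (v + w)) (zero : P 0) : P v :=
  Submodule.iSup_induction V (motive := P)
    (by rw [hV.submodule_iSup_eq_top]; trivial) mem zero add

theorem sum_summandProj (hV : DirectSum.IsInternal V) (s : Finset ι) (hs : ∀ i ∉ s, V i = ⊥)
    (v : M) : ∑ i ∈ s, summandProj V hV i v = v := by
  refine induction_of_isInternal hV (P := fun v => ∑ i ∈ s, summandProj V hV i v = v) v
    (fun i v hv => ?_) (fun v w h1 h2 => ?_) (by simp)
  · by_cases hi : i ∈ s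
    · rw [Finset.sum_eq_single_of_mem i hi fun j _ hj => summandProj_of_mem_ne hV hj.symm hv,
        summandProj_of_mem hV hv]
    · rw [hs i hi, Submodule.mem_bot] at hv
      simp [hv]
  · simp only [map_add, Finset.sum_add_distrib, h1, h2]

/-- An additive map which permutes the summands permutes the projections. -/
theorem summandProj_map (hV : DirectSum.IsInternal V) (σ : ι → ι) (hσ : Function.Injective σ)
    (T : M →+ M) (hT : ∀ i, ∀ v ∈ V i, T v ∈ V (σ i)) (i : ι) (v : M) :
    summandProj V hV (σ i) (T v) = T (summandProj V hV i v) := by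
  refine induction_of_isInternal hV
    (P := fun v => summandProj V hV (σ i) (T v) = T (summandProj V hV i v)) v
    (fun j v hv => ?_) (fun v w h1 h2 => ?_) (by simp)
  · by_cases hij : j = i
    · subst hij
      rw [summandProj_of_mem hV hv, summandProj_of_mem hV (hT _ _ hv)]
    · rw [summandProj_of_mem_ne hV hij hv,
        summandProj_of_mem_ne hV (fun h => hij (hσ h)) (hT _ _ hv), map_zero]
  · simp only [map_add, h1, h2]

end SummandProj

/-! ### The binomial expansion on a generalized eigenspace -/

theorem chooseCoeff_eq_zero {i j : ℕ} (h : i < j) : chooseCoeff i j = 0 := by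
  rw [chooseCoeff, coeff_eq_zero_of_natDegree_lt (by rwa [descPochhammer_natDegree]), zero_div]

theorem cast_choose_eq_sum (i k : ℕ) {n : ℕ} (h : i < n) :
    ((k.choose i : ℕ) : ℝ) = ∑ j ∈ Finset.range n, chooseCoeff i j * (k : ℝ) ^ j := by
  rw [Nat.cast_choose_eq_descPochhammer_div,
    eval_eq_sum_range' (n := n) (by rwa [descPochhammer_natDegree]), Finset.sum_div]
  exact Finset.sum_congr rfl fun j _ => by rw [chooseCoeff]; ring

/-- Powers of an operator on a vector killed by `(B - z) ^ m`. -/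
theorem pow_apply_eq_sum {K M : Type*} [Field K] [AddCommGroup M] [Module K M]
    (B : Module.End K M) (z : K) (hz : z ≠ 0) (m : ℕ) (w : M)
    (hw : ((B - z • (1 : Module.End K M)) ^ m) w = 0) (k : ℕ) :
    (B ^ k) w = ∑ i ∈ Finset.range m, ((k.choose i : K) * (z ^ i)⁻¹ * z ^ k) •
      ((B - z • (1 : Module.End K M)) ^ i) w := by
  set N := B - z • (1 : Module.End K M) with hN
  have hB : B = N + z • (1 : Module.End K M) := by rw [hN]; abel
  have hc : Commute N (z • (1 : Module.End K M)) := (Commute.one_right N).smul_right z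
  have key : (B ^ k) w = ∑ i ∈ Finset.range (k + 1),
      ((k.choose i : K) * (z ^ i)⁻¹ * z ^ k) • (N ^ i) w := by
    rw [hB, hc.add_pow, LinearMap.sum_apply]
    refine Finset.sum_congr rfl fun i hi => ?_
    have hik : i ≤ k := Nat.lt_succ_iff.1 (Finset.mem_range.1 hi)
    have : (z ^ i)⁻¹ * z ^ k = z ^ (k - i) := by
      rw [← Nat.add_sub_cancel' hik, pow_add, inv_mul_cancel_left₀ (pow_ne_zero _ hz)]
      simp
    rw [mul_assoc (k.choose i : K), this, _root_.smul_pow, one_pow, mul_smul_comm, mul_one,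
      ← nsmul_eq_mul', LinearMap.smul_apply, LinearMap.smul_apply, ← Nat.cast_smul_eq_nsmul K,
      smul_smul]
  rw [key]
  rcases le_total m (k + 1) with h | h
  · refine (Finset.sum_subset (Finset.range_subset_range.2 h) fun i _ hi => ?_).symm
    have hmi : m ≤ i := by simpa using hi
    have h0 : (N ^ i) w = 0 := by
      rw [← Nat.sub_add_cancel hmi, pow_add, Module.End.mul_apply, hw, map_zero]
    rw [h0, smul_zero]
  · refine Finset.sum_subset (Finset.range_subset_range.2 h) fun i _ hi => ?_
    have hki : k < i := by simpa using hi
    rw [Nat.choose_eq_zero_of_lt hki]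
    simp

/-- The values of a linear form on the orbit of a vector killed by `(B - z) ^ m`, as the product
of a polynomial in `k` by `z ^ k`. -/
theorem form_pow_apply {K M : Type*} [Field K] [Algebra ℝ K] [AddCommGroup M] [Module K M]
    (φ : M →ₗ[K] K) (B : Module.End K M) (z : K) (hz : z ≠ 0) (m : ℕ) (w : M)
    (hw : ((B - z • (1 : Module.End K M)) ^ m) w = 0) {n : ℕ} (hn : m ≤ n) (k : ℕ) :
    φ ((B ^ k) w) = (∑ j ∈ Finset.range n, (∑ i ∈ Finset.range m,
      algebraMap ℝ K (chooseCoeff i j) * (z ^ i)⁻¹ *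
        φ (((B - z • (1 : Module.End K M)) ^ i) w)) * (k : K) ^ j) * z ^ k := by
  rw [pow_apply_eq_sum B z hz m w hw k, map_sum]
  simp only [Finset.sum_mul]
  rw [Finset.sum_comm]
  refine Finset.sum_congr rfl fun i hi => ?_
  have := congrArg (algebraMap ℝ K)
    (cast_choose_eq_sum i k (lt_of_lt_of_le (Finset.mem_range.1 hi) hn))
  simp only [map_natCast, map_sum, map_mul, map_pow] at this
  rw [map_smul, this, smul_eq_mul]
  simp only [Finset.sum_mul]
  exact Finset.sum_congr rfl fun j _ => by ring

/-! ### Asymptotic non-termination as eventual positivity -/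

theorem mem_ANT_iff {E : Type*} [AddCommGroup E] [Module ℝ E]
    (A : Module.End ℝ E) (f : Module.Dual ℝ E) (x : E) :
    x ∈ ANT A f ↔ ∀ᶠ k in atTop, 0 < f ((A ^ k) x) := by
  simp only [ANT, TerminatesOn, Set.mem_ofPred_eq, not_exists, not_le, eventually_atTop]
  refine exists_congr fun K => ⟨fun h k hk => ?_, fun h k => ?_⟩
  · have := h (k - K)
    rwa [← Module.End.mul_apply, ← pow_add, Nat.sub_add_cancel hk] at this
  · rw [← Module.End.mul_apply, ← pow_add]
    exact h _ (Nat.le_add_left _ _)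

/-! ### Eigenvalues and the complexification -/

/-- On the generalized eigenspace of `z`, the operator `(B - z) ^ m` vanishes, where `m` is the
multiplicity of `z` in any nonzero polynomial annihilating `B`. -/
theorem pow_rootMultiplicity_apply_eq_zero {K M : Type*} [Field K] [AddCommGroup M] [Module K M]
    (B : Module.End K M) (p : K[X]) (hp : p ≠ 0) (hB : aeval B p = 0) (z : K) {w : M}
    (hw : w ∈ B.maxGenEigenspace z) :
    ((B - z • (1 : Module.End K M)) ^ p.rootMultiplicity z) w = 0 := by
  obtain ⟨N, hN⟩ := (Module.End.mem_maxGenEigenspace B z w).1 hw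
  obtain ⟨q, hq, hqz⟩ := p.exists_eq_pow_rootMultiplicity_mul_and_not_dvd hp z
  have hX : aeval B (X - C z) = B - z • (1 : Module.End K M) := by
    simp [Algebra.algebraMap_eq_smul_one]
  have hc : IsCoprime q ((X - C z) ^ N) :=
    (((irreducible_X_sub_C z).coprime_iff_not_dvd.2 hqz).pow_left (m := N)).symm
  refine (Submodule.disjoint_def.1 (disjoint_ker_aeval_of_isCoprime B hc)) _ ?_ ?_
  · rw [LinearMap.mem_ker, ← hX, ← map_pow, ← Module.End.mul_apply, ← map_mul, mul_comm, ← hq, hB,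
      LinearMap.zero_apply]
  · rw [LinearMap.mem_ker, map_pow, hX, ← Module.End.mul_apply, ← pow_add, add_comm, pow_add,
      Module.End.mul_apply, hN, map_zero]

variable {E : Type*} [AddCommGroup E] [Module ℝ E]

/-- Complex conjugation on the complexification of `E`. -/
noncomputable def conjC : (ℂ ⊗[ℝ] E) →ₗ[ℝ] ℂ ⊗[ℝ] E :=
  LinearMap.rTensor E Complex.conjAe.toLinearMap

@[simp] theorem conjC_tmul (a : ℂ) (x : E) :
    conjC (a ⊗ₜ[ℝ] x) = (starRingEnd ℂ) a ⊗ₜ[ℝ] x := rfl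

theorem conjC_smul (a : ℂ) (v : ℂ ⊗[ℝ] E) :
    conjC (a • v) = (starRingEnd ℂ) a • conjC v := by
  induction v with
  | zero => simp
  | tmul b x => simp [TensorProduct.smul_tmul']
  | add v w hv hw => simp only [smul_add, map_add, hv, hw]

theorem conjC_baseChange (A : Module.End ℝ E) (v : ℂ ⊗[ℝ] E) :
    conjC (A.baseChange ℂ v) = A.baseChange ℂ (conjC v) := by
  induction v with
  | zero => simp
  | tmul b x => simp
  | add v w hv hw => simp only [map_add, hv, hw]

theorem conjC_pow_sub (A : Module.End ℝ E) (z : ℂ) (i : ℕ) (v : ℂ ⊗[ℝ] E) :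
    conjC (((A.baseChange ℂ - z • (1 : Module.End ℂ (ℂ ⊗[ℝ] E))) ^ i) v) =
      ((A.baseChange ℂ - (starRingEnd ℂ) z • (1 : Module.End ℂ (ℂ ⊗[ℝ] E))) ^ i) (conjC v) := by
  induction i generalizing v with
  | zero => simp
  | succ i ih =>
    rw [pow_succ, Module.End.mul_apply, ih, pow_succ, Module.End.mul_apply]
    simp [conjC_baseChange, conjC_smul]

@[simp] theorem complexForm_tmul (f : Module.Dual ℝ E) (a : ℂ) (x : E) :
    complexForm f (a ⊗ₜ[ℝ] x) = a * f x := by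
  simp [complexForm, mul_comm]

theorem complexForm_conjC (f : Module.Dual ℝ E) (v : ℂ ⊗[ℝ] E) :
    complexForm f (conjC v) = (starRingEnd ℂ) (complexForm f v) := by
  induction v with
  | zero => simp
  | tmul b x => simp
  | add v w hv hw => simp only [map_add, hv, hw]

theorem baseChange_pow_tmul (A : Module.End ℝ E) (k : ℕ) (x : E) :
    ((A.baseChange ℂ) ^ k) ((1 : ℂ) ⊗ₜ[ℝ] x) = (1 : ℂ) ⊗ₜ[ℝ] (A ^ k) x := by
  rw [← LinearMap.baseChange_pow, LinearMap.baseChange_tmul]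

theorem baseChange_aeval (A : Module.End ℝ E) (p : ℝ[X]) :
    (aeval A p).baseChange ℂ = aeval (A.baseChange ℂ) (p.map (algebraMap ℝ ℂ)) := by
  rw [aeval_map_algebraMap]
  exact (aeval_algHom_apply (Module.End.baseChangeHom ℝ ℂ E) A p).symm

variable [FiniteDimensional ℝ E]

theorem charpoly_baseChange_eq (A : Module.End ℝ E) :
    (A.baseChange ℂ).charpoly = A.charpoly.map (algebraMap ℝ ℂ) :=
  LinearMap.charpoly_baseChange _ _

theorem map_charpoly_ne_zero (A : Module.End ℝ E) : A.charpoly.map (algebraMap ℝ ℂ) ≠ 0 :=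
  (A.charpoly_monic.map _).ne_zero

theorem mem_spec_iff (A : Module.End ℝ E) (z : ℂ) : z ∈ spec A ↔ 0 < mult A z := by
  rw [spec, Multiset.mem_toFinset, mult, aroots, mem_roots (map_charpoly_ne_zero A),
    rootMultiplicity_pos (map_charpoly_ne_zero A)]

theorem mult_conj (A : Module.End ℝ E) (z : ℂ) : mult A ((starRingEnd ℂ) z) = mult A z := by
  rw [mult, mult, eq_rootMultiplicity_map (p := A.charpoly.map (algebraMap ℝ ℂ))
    (f := starRingEnd ℂ) (RingHom.injective _) z, Polynomial.map_map]
  congr 2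
  ext x; simp

theorem conj_mem_spec {A : Module.End ℝ E} {z : ℂ} (h : z ∈ spec A) :
    (starRingEnd ℂ) z ∈ spec A := by
  rw [mem_spec_iff] at h ⊢
  rwa [mult_conj]

theorem pow_mult_apply_eq_zero (A : Module.End ℝ E) (z : ℂ) {w : ℂ ⊗[ℝ] E}
    (hw : w ∈ Module.End.maxGenEigenspace (A.baseChange ℂ) z) :
    ((A.baseChange ℂ - z • (1 : Module.End ℂ (ℂ ⊗[ℝ] E))) ^ mult A z) w = 0 := by
  refine pow_rootMultiplicity_apply_eq_zero _ _ (map_charpoly_ne_zero A) ?_ z hw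
  rw [← charpoly_baseChange_eq, LinearMap.aeval_self_charpoly]

theorem maxGenEigenspace_eq_bot {A : Module.End ℝ E} {z : ℂ} (hz : z ∉ spec A) :
    Module.End.maxGenEigenspace (A.baseChange ℂ) z = ⊥ := by
  rw [eq_bot_iff]
  intro w hw
  have := pow_mult_apply_eq_zero A z hw
  rw [mem_spec_iff, not_lt, Nat.le_zero] at hz
  simpa [hz] using this

/-- The real factor `charFactor w`, raised to any power, is coprime to the powers of `X - z` when
`z` is neither `w` nor its conjugate. -/
theorem isCoprime_charFactor {z w : ℂ} (h1 : z ≠ w) (h2 : z ≠ (starRingEnd ℂ) w) (m n : ℕ) :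
    IsCoprime (((charFactor w) ^ m).map (algebraMap ℝ ℂ)) ((X - C z) ^ n) := by
  have key : ∀ a b : ℂ, a ≠ b → IsCoprime (X - C a) (X - C b) := fun a b hab =>
    isCoprime_X_sub_C_of_isUnit_sub (sub_ne_zero.2 hab).isUnit
  rw [Polynomial.map_pow, charFactor_map]
  refine IsCoprime.pow ?_
  split_ifs
  · exact key _ _ h1.symm
  · exact (key _ _ h1.symm).mul_left (key _ _ h2.symm)

theorem complexComp_apply (A : Module.End ℝ E) (z : ℂ) (x : E) : complexComp A z x =
    summandProj _ (isInternal_maxGenEigenspace (A.baseChange ℂ)) z ((1 : ℂ) ⊗ₜ[ℝ] x) := rfl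

theorem complexComp_mem (A : Module.End ℝ E) (z : ℂ) (x : E) :
    complexComp A z x ∈ Module.End.maxGenEigenspace (A.baseChange ℂ) z :=
  summandProj_mem _ _ _

theorem sum_complexComp (A : Module.End ℝ E) (x : E) :
    ∑ z ∈ spec A, complexComp A z x = (1 : ℂ) ⊗ₜ[ℝ] x :=
  sum_summandProj (isInternal_maxGenEigenspace (A.baseChange ℂ)) (spec A)
    (fun _ hz => maxGenEigenspace_eq_bot hz) _

theorem complexComp_conj (A : Module.End ℝ E) (z : ℂ) (x : E) :
    complexComp A ((starRingEnd ℂ) z) x = conjC (complexComp A z x) := by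
  have := summandProj_map (isInternal_maxGenEigenspace (A.baseChange ℂ)) (starRingEnd ℂ)
    (RingHom.injective _) (conjC (E := E)).toAddMonoidHom (fun i v hv => ?_) z ((1 : ℂ) ⊗ₜ[ℝ] x)
  · simpa [complexComp_apply] using this
  · rw [Module.End.mem_maxGenEigenspace] at hv ⊢
    obtain ⟨k, hk⟩ := hv
    refine ⟨k, ?_⟩
    have := conjC_pow_sub A i k v
    rw [hk, map_zero] at this
    exact this.symm

theorem complexComp_eq_zero (A : Module.End ℝ E) {z w : ℂ} (h1 : z ≠ w)
    (h2 : z ≠ (starRingEnd ℂ) w) {x : E} (hx : x ∈ charSubspace A w) :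
    complexComp A z x = 0 := by
  rw [charSubspace_eq_ker_aeval, LinearMap.mem_ker] at hx
  obtain ⟨N, hN⟩ := (Module.End.mem_maxGenEigenspace _ _ _).1 (complexComp_mem A z x)
  refine (Submodule.disjoint_def.1 (disjoint_ker_aeval_of_isCoprime (A.baseChange ℂ)
    (isCoprime_charFactor h1 h2 (mult A w) N))) _ ?_ ?_
  · rw [LinearMap.mem_ker, complexComp_apply]
    have := summandProj_map (isInternal_maxGenEigenspace (A.baseChange ℂ)) id
      Function.injective_id (aeval (A.baseChange ℂ)
        ((charFactor w ^ mult A w).map (algebraMap ℝ ℂ))).toAddMonoidHom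
      (fun i v hv => ?_) z ((1 : ℂ) ⊗ₜ[ℝ] x)
    · refine this.symm.trans ?_
      have h0 : (aeval (A.baseChange ℂ) ((charFactor w ^ mult A w).map (algebraMap ℝ ℂ)))
          ((1 : ℂ) ⊗ₜ[ℝ] x) = 0 := by
        rw [← baseChange_aeval, LinearMap.baseChange_tmul, hx, TensorProduct.tmul_zero]
      exact (congrArg _ h0).trans (map_zero _)
    · exact Module.End.mapsTo_maxGenEigenspace_of_comm
        (by simpa only [aeval_X] using (Commute.all X ((charFactor w ^ mult A w).map
          (algebraMap ℝ ℂ))).map (aeval (A.baseChange ℂ))) i hv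
  · rw [LinearMap.mem_ker]
    simpa [Algebra.algebraMap_eq_smul_one] using hN

theorem sum_comp (A : Module.End ℝ E) (x : E) : ∑ w ∈ indexSpec A, comp A w x = x := by
  have h := sum_summandProj (isInternal_charSubspace A) Finset.univ (by simp) x
  rw [← Finset.sum_coe_sort]
  refine Eq.trans (Finset.sum_congr rfl fun w _ => ?_) h
  rw [comp, dif_pos w.2]

theorem comp_mem (A : Module.End ℝ E) (z : ℂ) (x : E) : comp A z x ∈ charSubspace A z := by
  unfold comp
  split_ifs with h
  · exact summandProj_mem (isInternal_charSubspace A) ⟨z, h⟩ x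
  · exact zero_mem _

theorem complexComp_comp (A : Module.End ℝ E) {z : ℂ} (hz : z ∈ indexSpec A) (x : E) :
    complexComp A z (comp A z x) = complexComp A z x := by
  conv_rhs => rw [← sum_comp A x, map_sum]
  refine (Finset.sum_eq_single_of_mem (f := fun w => complexComp A z (comp A w x)) z hz
    fun w hw hne => ?_).symm
  refine complexComp_eq_zero A hne.symm (fun h => ?_) (comp_mem A w x)
  -- Two conjugate indices are equal, as both have nonnegative imaginary part.
  have h1 := (Finset.mem_filter.1 hz).2
  have h2 := (Finset.mem_filter.1 hw).2
  have h3 := congrArg Complex.im h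
  simp only [Complex.conj_im] at h3
  refine hne (Complex.ext ?_ (by linarith))
  rw [h, Complex.conj_re]

theorem complexComp_real (A : Module.End ℝ E) {t : ℝ} (ht : (t : ℂ) ∈ spec A) {x : E}
    (hx : x ∈ charSubspace A (t : ℂ)) : complexComp A (t : ℂ) x = (1 : ℂ) ⊗ₜ[ℝ] x := by
  conv_rhs => rw [← sum_complexComp A x]
  refine (Finset.sum_eq_single_of_mem (f := fun w => complexComp A w x) _ ht
    fun w _ hw => ?_).symm
  exact complexComp_eq_zero A hw (by simpa using hw) hx

/-- The dimension of `E_{μ, conj μ}` is at least `2 d_μ`: its complexification contains the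
generalized eigenspaces of `μ` and of `conj μ`. -/
theorem mult_le_half_finrank (A : Module.End ℝ E) {μ : ℂ} (hμ : 0 < μ.im) :
    mult A μ ≤ Module.finrank ℝ (charSubspace A μ) / 2 := by
  have hne : μ ≠ (starRingEnd ℂ) μ := fun h => by
    have := congrArg Complex.im h
    simp only [Complex.conj_im] at this
    linarith
  set B : Module.End ℂ (ℂ ⊗[ℝ] E) := A.baseChange ℂ with hB
  set T := aeval A (charFactor μ ^ mult A μ) with hT
  have hfin : ∀ z, Module.finrank ℂ (B.maxGenEigenspace z) = mult A z := fun z => by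
    rw [LinearMap.finrank_maxGenEigenspace_eq, hB, charpoly_baseChange_eq, mult]
  have hle : ∀ z, (z = μ ∨ z = (starRingEnd ℂ) μ) →
      B.maxGenEigenspace z ≤ LinearMap.ker (T.baseChange ℂ) := by
    intro z hz w hw
    have hm : mult A z = mult A μ := by
      rcases hz with rfl | rfl
      · rfl
      · exact mult_conj A μ
    have h1 := pow_mult_apply_eq_zero A z hw
    have hd : (X - C z) ^ mult A μ ∣ (charFactor μ ^ mult A μ).map (algebraMap ℝ ℂ) := by
      rw [Polynomial.map_pow, charFactor_map, if_neg hμ.ne']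
      refine pow_dvd_pow_of_dvd ?_ _
      rcases hz with rfl | rfl
      · exact dvd_mul_right _ _
      · exact dvd_mul_left _ _
    obtain ⟨q, hq⟩ := hd
    rw [LinearMap.mem_ker, hT, baseChange_aeval, hq, mul_comm, map_mul, Module.End.mul_apply]
    have h2 : (aeval (A.baseChange ℂ) ((X - C z) ^ mult A μ)) w = 0 := by
      rw [← hm]
      simpa [Algebra.algebraMap_eq_smul_one] using h1
    rw [h2, map_zero]
  have hdisj : Disjoint (B.maxGenEigenspace μ) (B.maxGenEigenspace ((starRingEnd ℂ) μ)) :=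
    B.independent_maxGenEigenspace.pairwiseDisjoint hne
  have h2 : 2 * mult A μ ≤ Module.finrank ℂ (LinearMap.ker (T.baseChange ℂ)) := by
    have := Submodule.finrank_sup_add_finrank_inf_eq (B.maxGenEigenspace μ)
      (B.maxGenEigenspace ((starRingEnd ℂ) μ))
    rw [hdisj.eq_bot, finrank_bot, hfin, hfin, mult_conj] at this
    have h3 := Submodule.finrank_mono (sup_le (hle _ (Or.inl rfl)) (hle _ (Or.inr rfl)))
    omega
  have h3 : Module.finrank ℂ (LinearMap.ker (T.baseChange ℂ)) ≤
      Module.finrank ℝ (charSubspace A μ) := by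
    -- By flatness, the kernel of the complexification is the complexification of the kernel.
    have hex : Function.Exact ((LinearMap.ker T).subtype.lTensor ℂ) (T.lTensor ℂ) :=
      Module.Flat.lTensor_exact ℂ (LinearMap.exact_subtype_ker_map T)
    have hr : LinearMap.ker (T.baseChange ℂ) ≤
        LinearMap.range ((LinearMap.ker T).subtype.baseChange ℂ) := fun w hw => (hex w).1 hw
    refine (Submodule.finrank_mono hr).trans ((LinearMap.finrank_range_le _).trans ?_)
    rw [Module.finrank_baseChange, charSubspace_eq_ker_aeval]
  omega

theorem mult_le_maxHalfDim (A : Module.End ℝ E) {τ : ℝ} {μ : ℂ} (hμ : μ ∈ upperSpec A τ) :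
    mult A μ ≤ maxHalfDim A τ :=
  (mult_le_half_finrank A (Finset.mem_filter.1 hμ).2.1).trans
    (Finset.le_sup (f := fun μ => Module.finrank ℝ (charSubspace A μ) / 2) hμ)

/-! ### Closed forms of the orbit values -/

theorem alpha_apply (A : Module.End ℝ E) (f : Module.Dual ℝ E) (t : ℝ) (j : ℕ) (x : E) :
    alpha A f t j x = ∑ i ∈ Finset.range (mult A (t : ℂ)),
      chooseCoeff i j * (t ^ i)⁻¹ * f (((A - t • (1 : Module.End ℝ E)) ^ i) x) := by
  simp [alpha, LinearMap.sum_apply]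

theorem aCoeff_apply (A : Module.End ℝ E) (f : Module.Dual ℝ E) (z : ℂ) (j : ℕ) (x : E) :
    aCoeff A f z j x = ∑ i ∈ Finset.range (mult A z),
      (chooseCoeff i j : ℂ) * (z ^ i)⁻¹ * complexForm f
        (((A.baseChange ℂ - z • (1 : Module.End ℂ (ℂ ⊗[ℝ] E))) ^ i) (complexComp A z x)) := by
  simp [aCoeff, LinearMap.sum_apply]

theorem aCoeff_conj (A : Module.End ℝ E) (f : Module.Dual ℝ E) (z : ℂ) (j : ℕ) (x : E) :
    aCoeff A f ((starRingEnd ℂ) z) j x = (starRingEnd ℂ) (aCoeff A f z j x) := by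
  rw [aCoeff_apply, aCoeff_apply, mult_conj, map_sum]
  refine Finset.sum_congr rfl fun i _ => ?_
  rw [complexComp_conj, ← conjC_pow_sub, complexForm_conjC]
  simp

theorem aCoeff_eq_zero_of_mult_le (A : Module.End ℝ E) (f : Module.Dual ℝ E) {z : ℂ} {j : ℕ}
    (h : mult A z ≤ j) (x : E) : aCoeff A f z j x = 0 := by
  rw [aCoeff_apply]
  refine Finset.sum_eq_zero fun i hi => ?_
  rw [chooseCoeff_eq_zero (lt_of_lt_of_le (Finset.mem_range.1 hi) h)]
  simp

theorem aCoeff_comp (A : Module.End ℝ E) (f : Module.Dual ℝ E) {z : ℂ} (hz : z ∈ indexSpec A)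
    (j : ℕ) (x : E) : aCoeff A f z j (comp A z x) = aCoeff A f z j x := by
  rw [aCoeff_apply, aCoeff_apply, complexComp_comp A hz]

/-- For a real eigenvalue `t` the complex coefficients are the real ones. -/
theorem aCoeff_real (A : Module.End ℝ E) (f : Module.Dual ℝ E) {t : ℝ} (ht : (t : ℂ) ∈ spec A)
    (j : ℕ) (x : E) : aCoeff A f (t : ℂ) j x = (alpha A f t j (comp A (t : ℂ) x) : ℝ) := by
  have hi : (t : ℂ) ∈ indexSpec A := Finset.mem_filter.2 ⟨ht, by simp⟩
  rw [← aCoeff_comp A f hi, aCoeff_apply, alpha_apply, complexComp_real A ht (comp_mem A _ x)]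
  push_cast
  refine Finset.sum_congr rfl fun i _ => ?_
  have : A.baseChange ℂ - (t : ℂ) • (1 : Module.End ℂ (ℂ ⊗[ℝ] E)) =
      (A - t • (1 : Module.End ℝ E)).baseChange ℂ := by
    rw [LinearMap.baseChange_sub, LinearMap.baseChange_smul, LinearMap.baseChange_one]
    rfl
  rw [this, baseChange_pow_tmul, complexForm_tmul, one_mul]

theorem complexForm_pow_complexComp (A : Module.End ℝ E) (f : Module.Dual ℝ E) {z : ℂ}
    (hz : z ≠ 0) {n : ℕ} (hn : mult A z ≤ n) (x : E) (k : ℕ) :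
    complexForm f (((A.baseChange ℂ) ^ k) (complexComp A z x)) =
      (∑ j ∈ Finset.range n, aCoeff A f z j x * (k : ℂ) ^ j) * z ^ k := by
  rw [form_pow_apply (complexForm f) (A.baseChange ℂ) z hz (mult A z) _
    (pow_mult_apply_eq_zero A z (complexComp_mem A z x)) hn k]
  simp only [aCoeff_apply, Complex.coe_algebraMap]

theorem ofReal_form_eq_sum (A : Module.End ℝ E) (f : Module.Dual ℝ E) (x : E) (k : ℕ) :
    ((f ((A ^ k) x) : ℝ) : ℂ) =
      ∑ z ∈ spec A, complexForm f (((A.baseChange ℂ) ^ k) (complexComp A z x)) := by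
  rw [← map_sum, ← map_sum, sum_complexComp, baseChange_pow_tmul, complexForm_tmul, one_mul]

theorem form_pow_eq_of_mem_charSubspace (A : Module.End ℝ E) (f : Module.Dual ℝ E) {t : ℝ}
    (ht : 0 < t) {x : E} (hx : x ∈ charSubspace A (t : ℂ)) (k : ℕ) :
    f ((A ^ k) x) = (∑ i ∈ Finset.range (mult A (t : ℂ)), alpha A f t i x * (k : ℝ) ^ i) *
      t ^ k := by
  have hx' : ((A - t • (1 : Module.End ℝ E)) ^ mult A (t : ℂ)) x = 0 := by
    simpa [charSubspace, charOp] using hx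
  rw [form_pow_apply f A t ht.ne' _ x hx' le_rfl k]
  simp only [alpha_apply, Algebra.algebraMap_self, RingHom.id_apply]

theorem form_pow_eq_of_mem_sigmaSpace (A : Module.End ℝ E) (f : Module.Dual ℝ E) {τ : ℝ}
    (hτ : 0 < τ) {x : E} (hx : x ∈ sigmaSpace A τ) (k : ℕ) :
    ((f ((A ^ k) x) : ℝ) : ℂ) = (∑ j ∈ Finset.range (maxHalfDim A τ),
      (∑ μ ∈ upperSpec A τ, (aCoeff A f μ j x * (μ / (τ : ℂ)) ^ k +
        (starRingEnd ℂ) (aCoeff A f μ j x * (μ / (τ : ℂ)) ^ k))) * (k : ℂ) ^ j) *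
      (τ : ℂ) ^ k := by
  have hτ' : (τ : ℂ) ≠ 0 := by exact_mod_cast hτ.ne'
  set F : ℂ → ℂ := fun z => complexForm f (((A.baseChange ℂ) ^ k) (complexComp A z x)) with hF
  have hup : ∀ μ ∈ upperSpec A τ, μ ∈ spec A ∧ 0 < μ.im ∧ ‖μ‖ = τ := fun μ hμ =>
    Finset.mem_filter.1 hμ
  -- Only the eigenvalues in `A_τ` and their conjugates contribute.
  have hzero : ∀ z, z ∉ upperSpec A τ → (starRingEnd ℂ) z ∉ upperSpec A τ → F z = 0 := by
    intro z h1 h2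
    have hle : sigmaSpace A τ ≤ LinearMap.ker (complexComp A z) := iSup₂_le fun μ hμ y hy =>
      complexComp_eq_zero A (z := z) (w := μ) (fun h => h1 (by rwa [h]))
        (fun h => h2 (by rwa [h, Complex.conj_conj])) hy
    have : complexComp A z x = 0 := hle hx
    simp [hF, this]
  have hdisj : Disjoint (upperSpec A τ) ((upperSpec A τ).image (starRingEnd ℂ)) := by
    rw [Finset.disjoint_left]
    intro z hz hz'
    obtain ⟨w, hw, rfl⟩ := Finset.mem_image.1 hz'
    have h1 := (hup _ hz).2.1
    have h2 := (hup _ hw).2.1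
    simp only [Complex.conj_im] at h1
    linarith
  have hsub : upperSpec A τ ∪ (upperSpec A τ).image (starRingEnd ℂ) ⊆ spec A := by
    intro z hz
    rcases Finset.mem_union.1 hz with h | h
    · exact (hup _ h).1
    · obtain ⟨w, hw, rfl⟩ := Finset.mem_image.1 h
      exact conj_mem_spec (hup _ hw).1
  have hconj : ∀ z, F ((starRingEnd ℂ) z) = (starRingEnd ℂ) (F z) := by
    intro z
    simp only [hF]
    rw [complexComp_conj, ← complexForm_conjC]
    congr 1
    have := conjC_pow_sub A 0 k (complexComp A z x)
    simp only [map_zero, zero_smul, sub_zero] at this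
    exact this.symm
  have hval : ∀ μ ∈ upperSpec A τ, F μ = (∑ j ∈ Finset.range (maxHalfDim A τ),
      aCoeff A f μ j x * (k : ℂ) ^ j) * μ ^ k := fun μ hμ =>
    complexForm_pow_complexComp A f (fun h => by have := (hup _ hμ).2.1; simp [h] at this)
      (mult_le_maxHalfDim A hμ) x k
  rw [ofReal_form_eq_sum, ← Finset.sum_subset (f := F) hsub, Finset.sum_union hdisj,
    Finset.sum_image fun a _ b _ h => (starRingEnd ℂ).injective h, ← Finset.sum_add_distrib]
  · simp only [Finset.sum_mul]
    rw [Finset.sum_comm]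
    refine Finset.sum_congr rfl fun μ hμ => ?_
    rw [hconj, hval μ hμ, Finset.sum_mul, map_sum, ← Finset.sum_add_distrib]
    refine Finset.sum_congr rfl fun j _ => ?_
    simp only [map_mul, map_pow, map_div₀, Complex.conj_ofReal, map_natCast, div_pow]
    field_simp
  · intro z _ hz
    rw [Finset.mem_union, not_or] at hz
    exact hzero z hz.1 fun h => hz.2 (Finset.mem_image.2 ⟨_, h, Complex.conj_conj z⟩)

/-- For large `k` the eigenvalue `0` does not contribute. -/
theorem eventually_form_eq_expPoly (A : Module.End ℝ E) (f : Module.Dual ℝ E) (x : E) :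
    ∀ᶠ k in atTop, ((f ((A ^ k) x) : ℝ) : ℂ) = expPoly ((spec A).erase 0)
      ((spec A).sup (mult A)) (fun z j => aCoeff A f z j x) k := by
  filter_upwards [eventually_ge_atTop (mult A 0)] with k hk
  have h0 : complexForm f (((A.baseChange ℂ) ^ k) (complexComp A 0 x)) = 0 := by
    have := pow_mult_apply_eq_zero A 0 (complexComp_mem A 0 x)
    simp only [zero_smul, sub_zero] at this
    have h1 : ((A.baseChange ℂ) ^ k) (complexComp A 0 x) = 0 := by
      rw [← Nat.sub_add_cancel hk, pow_add]
      change ((A.baseChange ℂ) ^ (k - mult A 0)) (((A.baseChange ℂ) ^ mult A 0) _) = 0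
      rw [this, map_zero]
    rw [h1, map_zero]
  rw [ofReal_form_eq_sum, ← Finset.sum_erase (f := fun z => complexForm f
    (((A.baseChange ℂ) ^ k) (complexComp A z x))) _ h0, expPoly]
  refine Finset.sum_congr rfl fun z hz => ?_
  rw [Finset.mem_erase] at hz
  rw [complexForm_pow_complexComp A f hz.1 (Finset.le_sup hz.2) x k, Finset.sum_mul]

/-! ### The sets `S_{t,l}` -/

/-- The set `S_{t,l}` in terms of the coefficients attached to all complex eigenvalues: `(t, l)` is
the dominant pair, and its coefficient is positive. -/
theorem mem_setS_iff {A : Module.End ℝ E} (hA : AssumptionH A) (f : Module.Dual ℝ E) {t : ℝ}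
    (ht : t ∈ posSpec A) (l : ℕ) (x : E) :
    x ∈ setS A f t l ↔ (∀ z ∈ spec A, t < ‖z‖ → ∀ j, aCoeff A f z j x = 0) ∧
      (∀ j, l < j → aCoeff A f (t : ℂ) j x = 0) ∧ 0 < (aCoeff A f (t : ℂ) l x).re := by
  have hreal : ∀ s : ℝ, (s : ℂ) ∈ spec A → ∀ j,
      aCoeff A f (s : ℂ) j x = 0 ↔ alpha A f s j (comp A (s : ℂ) x) = 0 := fun s hs j => by
    rw [aCoeff_real A f hs, Complex.ofReal_eq_zero]
  refine and_congr
    ⟨fun h z hz htz j => ?_, fun h τ _ htτ => ⟨fun _ μ hμ j _ => ?_, fun hs i _ => ?_⟩⟩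
    (and_congr ⟨fun h j hj => ?_, fun h j hj _ => ?_⟩ ?_)
  · obtain ⟨h1, h2⟩ := h ‖z‖ ⟨z, hz, rfl⟩ htz
    by_cases hs : ((‖z‖ : ℝ) : ℂ) ∈ spec A
    · rw [hA.eq_of_norm_eq ‖z‖ ⟨ht.1.trans htz, hs⟩ z hz rfl]
      by_cases hj : j < mult A ((‖z‖ : ℝ) : ℂ)
      · exact (hreal _ hs j).2 (h2 hs j hj)
      · exact aCoeff_eq_zero_of_mult_le A f (not_lt.1 hj) x
    · have key : ∀ μ ∈ upperSpec A ‖z‖, aCoeff A f μ j x = 0 := by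
        intro μ hμ
        by_cases hj : j < maxHalfDim A ‖z‖
        · have := Finset.mem_filter.1 hμ
          rw [← aCoeff_comp A f (Finset.mem_filter.2 ⟨this.1, this.2.1.le⟩)]
          exact h1 hs μ hμ j hj
        · exact aCoeff_eq_zero_of_mult_le A f ((mult_le_maxHalfDim A hμ).trans (not_lt.1 hj)) x
      rcases lt_trichotomy z.im 0 with him | him | him
      · have := key ((starRingEnd ℂ) z)
          (Finset.mem_filter.2 ⟨conj_mem_spec hz, by simpa using him, by simp⟩)
        rwa [aCoeff_conj, map_eq_zero] at this
      · -- A real eigenvalue is nonnegative, hence equal to its modulus.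
        have hzr : (z.re : ℂ) = z := Complex.ext (by simp) (by simp [him])
        have h0 := hA.nonneg_of_real z.re (hzr ▸ hz)
        have hn : ‖z‖ = z.re := by rw [← hzr, Complex.norm_real, Real.norm_of_nonneg h0]; simp
        exact absurd (by rwa [hn, hzr]) hs
      · exact key z (Finset.mem_filter.2 ⟨hz, him, rfl⟩)
  · have hμ' := Finset.mem_filter.1 hμ
    rw [aCoeff_comp A f (Finset.mem_filter.2 ⟨hμ'.1, hμ'.2.1.le⟩)]
    exact h μ hμ'.1 (by rw [hμ'.2.2]; exact htτ) j
  · refine (hreal _ hs i).1 (h _ hs ?_ i)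
    rwa [Complex.norm_real, Real.norm_of_nonneg (ht.1.trans htτ).le]
  · by_cases hj' : j < mult A (t : ℂ)
    · exact (hreal _ ht.2 j).2 (h j hj hj')
    · exact aCoeff_eq_zero_of_mult_le A f (not_lt.1 hj') x
  · exact (hreal _ ht.2 j).1 (h j hj)
  · rw [aCoeff_real A f ht.2, Complex.ofReal_re]

/-- The common zeros of any set of linear forms are the common zeros of a finite set, because the
dual space is Noetherian. -/
theorem exists_finset_forall_eq_zero_iff (T : Set (Module.Dual ℝ E)) :
    ∃ G : Finset (Module.Dual ℝ E), ∀ x, (∀ g ∈ G, g x = 0) ↔ ∀ g ∈ T, g x = 0 := by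
  obtain ⟨G, hG⟩ := IsNoetherian.noetherian (Submodule.span ℝ T)
  have key : ∀ (S : Set (Module.Dual ℝ E)) (x : E),
      (∀ g ∈ S, g x = 0) ↔ ∀ g ∈ Submodule.span ℝ S, g x = 0 := fun S x =>
    ⟨fun h => (Submodule.span_le (p := LinearMap.ker (Module.Dual.eval ℝ E x))).2 h,
      fun h g hg => h g (Submodule.subset_span hg)⟩
  exact ⟨G, fun x => by rw [key T, ← hG, ← key]; rfl⟩

theorem exists_setS_eq {A : Module.End ℝ E} (hA : AssumptionH A) (f : Module.Dual ℝ E) {t : ℝ}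
    (ht : t ∈ posSpec A) (l : ℕ) :
    ∃ (G : Finset (Module.Dual ℝ E)) (h : Module.Dual ℝ E),
      setS A f t l = {x | (∀ g ∈ G, g x = 0) ∧ 0 < h x} := by
  -- The complex equations are split into real and imaginary parts.
  let T : Set (Module.Dual ℝ E) := {g | ∃ z j, ((z ∈ spec A ∧ t < ‖z‖) ∨ (z = t ∧ l < j)) ∧
    (g = Complex.reLm ∘ₗ aCoeff A f z j ∨ g = Complex.imLm ∘ₗ aCoeff A f z j)}
  obtain ⟨G, hG⟩ := exists_finset_forall_eq_zero_iff T
  refine ⟨G, Complex.reLm ∘ₗ aCoeff A f (t : ℂ) l, Set.ext fun x => ?_⟩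
  rw [mem_setS_iff hA f ht, Set.mem_ofPred_eq, hG, ← and_assoc]
  refine and_congr ⟨?_, fun h => ?_⟩ Iff.rfl
  · rintro ⟨h1, h2⟩ g ⟨z, j, hz, hg⟩
    have h0 : aCoeff A f z j x = 0 := by
      rcases hz with hz | ⟨rfl, hj⟩
      · exact h1 z hz.1 hz.2 j
      · exact h2 j hj
    rcases hg with rfl | rfl <;> simp [h0]
  · have key : ∀ z j, ((z ∈ spec A ∧ t < ‖z‖) ∨ (z = t ∧ l < j)) → aCoeff A f z j x = 0 :=
      fun z j hz => Complex.ext (h _ ⟨z, j, hz, Or.inl rfl⟩) (h _ ⟨z, j, hz, Or.inr rfl⟩)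
    exact ⟨fun z hz htz j => key z j (Or.inl ⟨hz, htz⟩), fun j hj => key _ j (Or.inr ⟨rfl, hj⟩)⟩

theorem pairwiseDisjoint_setS {A : Module.End ℝ E} (hA : AssumptionH A) (f : Module.Dual ℝ E) :
    (deltaS A).PairwiseDisjoint fun p => setS A f p.1 p.2 := by
  -- The pair with the smaller modulus, or the smaller degree, forces the other one to vanish.
  have key : ∀ p ∈ deltaS A, ∀ q ∈ deltaS A, (p.1 < q.1 ∨ (p.1 = q.1 ∧ p.2 < q.2)) → ∀ x,
      x ∈ setS A f p.1 p.2 → x ∈ setS A f q.1 q.2 → False := by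
    intro p hp q hq hpq x hxp hxq
    rw [mem_setS_iff hA f hp.1] at hxp
    rw [mem_setS_iff hA f hq.1] at hxq
    have h0 : aCoeff A f (q.1 : ℂ) q.2 x = 0 := by
      rcases hpq with h | ⟨h, h'⟩
      · exact hxp.1 _ hq.1.2 (by rwa [Complex.norm_real, Real.norm_of_nonneg hq.1.1.le]) _
      · rw [← h]; exact hxp.2.1 _ h'
    simpa [h0] using hxq.2.2
  intro p hp q hq hne
  rw [Function.onFun, Set.disjoint_left]
  intro x hxp hxq
  rcases lt_trichotomy p.1 q.1 with h | h | h
  · exact key p hp q hq (Or.inl h) x hxp hxq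
  · rcases lt_trichotomy p.2 q.2 with h' | h' | h'
    · exact key p hp q hq (Or.inr ⟨h, h'⟩) x hxp hxq
    · exact hne (Prod.ext h h')
    · exact key q hq p hp (Or.inr ⟨h.symm, h'⟩) x hxq hxp
  · exact key q hq p hp (Or.inl h) x hxq hxp

theorem ANT_eq_iUnion_setS {A : Module.End ℝ E} (hA : AssumptionH A) (f : Module.Dual ℝ E) :
    ANT A f = ⋃ p ∈ deltaS A, setS A f p.1 p.2 := by
  ext x
  rw [mem_ANT_iff, Set.mem_iUnion₂]
  have hpos : ∀ t : ℝ, (t : ℂ) ∈ (spec A).erase 0 → t ∈ posSpec A := fun t ht => by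
    rw [Finset.mem_erase, Complex.ofReal_ne_zero] at ht
    exact ⟨lt_of_le_of_ne (hA.nonneg_of_real t ht.2) ht.1.symm, ht.2⟩
  have hmult : ∀ z ∈ spec A, ∀ j, aCoeff A f z j x ≠ 0 → j < (spec A).sup (mult A) :=
    fun z hz j h => lt_of_lt_of_le
      (not_le.1 fun h' => h (aCoeff_eq_zero_of_mult_le A f h' x)) (Finset.le_sup hz)
  constructor
  · intro h
    obtain ⟨t, ht, l, hl, h1, h2, h3⟩ := exists_dominant_of_eventually_pos _ _ _ _
      (Finset.notMem_erase 0 (spec A)) (eventually_form_eq_expPoly A f x)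
      (fun t ht z hz => hA.eq_of_norm_eq t (hpos t ht) z (Finset.mem_of_mem_erase hz)) h
    have htp := hpos t ht
    refine ⟨(t, l), ⟨htp, not_le.1 fun h' => ?_⟩, (mem_setS_iff hA f htp l x).2 ⟨?_, ?_, h3⟩⟩
    · simp [aCoeff_eq_zero_of_mult_le A f h' x] at h3
    · intro z hz htz j
      by_contra hne
      have hz0 : z ≠ 0 := norm_pos_iff.1 (htp.1.trans htz)
      exact hne (h1 z (Finset.mem_erase.2 ⟨hz0, hz⟩) htz j (hmult z hz j hne))
    · intro j hj
      by_contra hne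
      exact hne (h2 j (hmult _ htp.2 j hne) hj)
  · rintro ⟨⟨t, l⟩, ⟨htp, hl⟩, hx⟩
    obtain ⟨h1, h2, h3⟩ := (mem_setS_iff hA f htp l x).1 hx
    have ht0 : (t : ℂ) ≠ 0 := by exact_mod_cast htp.1.ne'
    exact eventually_pos_of_dominant _ _ _ _ (eventually_form_eq_expPoly A f x) htp.1
      (lt_of_lt_of_le hl (Finset.le_sup htp.2)) (Finset.mem_erase.2 ⟨ht0, htp.2⟩)
      (fun z hz => hA.eq_of_norm_eq t htp z (Finset.mem_of_mem_erase hz))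
      (fun z hz htz j _ => h1 z (Finset.mem_of_mem_erase hz) htz j) (fun j _ hj => h2 j hj) h3

theorem finite_deltaS (A : Module.End ℝ E) : (deltaS A).Finite := by
  refine (((spec A).image Complex.re ×ˢ Finset.range ((spec A).sup (mult A))).finite_toSet).subset
    fun p hp => ?_
  rw [Finset.mem_coe, Finset.mem_product, Finset.mem_range]
  exact ⟨Finset.mem_image.2 ⟨p.1, hp.1.2, Complex.ofReal_re _⟩,
    lt_of_lt_of_le hp.2 (Finset.le_sup hp.1.2)⟩

theorem isSemilinear_ANT {A : Module.End ℝ E} (hA : AssumptionH A) (f : Module.Dual ℝ E) :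
    IsSemilinear (ANT A f) := by
  choose G h hG using fun p : deltaS A => exists_setS_eq hA f p.2.1 p.1.2
  have := (finite_deltaS A).to_subtype
  obtain ⟨n, ⟨e⟩⟩ := Finite.exists_equiv_fin (deltaS A)
  refine ⟨n, fun i => G (e.symm i), fun i => {h (e.symm i)}, ?_⟩
  rw [ANT_eq_iUnion_setS hA f, Set.biUnion_eq_iUnion, ← e.symm.surjective.iUnion_comp]
  refine Set.iUnion_congr fun i => ?_
  rw [hG]
  simp

end LoopANT

theorem mainTheorem2 {E : Type*} [AddCommGroup E] [Module ℝ E] [FiniteDimensional ℝ E]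
    (A : Module.End ℝ E) (f : Module.Dual ℝ E) (hA : LoopANT.AssumptionH A) :
    -- the closed form of `f (A ^ k x)` on `E_t`, with coefficients `α_{t,i}`
    (∀ t ∈ LoopANT.posSpec A, ∀ x ∈ LoopANT.charSubspace A (t : ℂ), ∀ k : ℕ,
      f ((A ^ k) x) =
        (∑ i ∈ Finset.range (LoopANT.mult A (t : ℂ)),
          LoopANT.alpha A f t i x * (k : ℝ) ^ i) * t ^ k) ∧
    -- the closed form of `f (A ^ k x)` on `Σ_τ`, with coefficients `a_{μ,j}`
    (∀ τ ∈ LoopANT.absSpec A, 0 < τ → τ ∉ LoopANT.posSpec A →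
      ∀ x ∈ LoopANT.sigmaSpace A τ, ∀ k : ℕ,
        ((f ((A ^ k) x) : ℝ) : ℂ) =
          (∑ j ∈ Finset.range (LoopANT.maxHalfDim A τ),
            (∑ μ ∈ LoopANT.upperSpec A τ,
              (LoopANT.aCoeff A f μ j x * (μ / (τ : ℂ)) ^ k +
                (starRingEnd ℂ) (LoopANT.aCoeff A f μ j x * (μ / (τ : ℂ)) ^ k))) *
              (k : ℂ) ^ j) * (τ : ℂ) ^ k) ∧
    -- each `S_{t,l}` is cut out by finitely many linear equalities and a strict inequality
    (∀ p ∈ LoopANT.deltaS A, ∃ (G : Finset (Module.Dual ℝ E)) (h : Module.Dual ℝ E),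
      LoopANT.setS A f p.1 p.2 = {x | (∀ g ∈ G, g x = 0) ∧ 0 < h x}) ∧
    -- the set of asymptotically non-terminating inputs is the disjoint union of the `S_{t,l}`
    (LoopANT.deltaS A).PairwiseDisjoint (fun p => LoopANT.setS A f p.1 p.2) ∧
    LoopANT.ANT A f = ⋃ p ∈ LoopANT.deltaS A, LoopANT.setS A f p.1 p.2 ∧
    LoopANT.IsSemilinear (LoopANT.ANT A f) := by
  exact ⟨fun t ht x hx k => LoopANT.form_pow_eq_of_mem_charSubspace A f ht.1 hx k,
    fun τ _ hτ _ x hx k => LoopANT.form_pow_eq_of_mem_sigmaSpace A f hτ hx k,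
    fun p hp => LoopANT.exists_setS_eq hA f hp.1 p.2,
    LoopANT.pairwiseDisjoint_setS hA f, LoopANT.ANT_eq_iUnion_setS hA f,
    LoopANT.isSemilinear_ANT hA f⟩
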